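/- Let $E$ be a finite-dimensional real Banach space and let $C\subset E$ be an open convex cone (that is, $C$ is open, $C+C\subset C$ and $tC\subset C$ for $t>0$) whose closure $\overline C$ is a proper cone, i.e. $\overline C\cap(-\overline C)=\{0\}$. Write $x\le y$ if $y-x\in\overline C$, and equip $C$ with the Thompson metric $$d_T(x,y)=\max\{\log M(x/y),\log M(y/x)\},\qquad M(x/y)=\inf\{\lambda>0: x\le\lambda y\}$$ (with $d_T=0$ in the trivial case $E=\{0\}$), whose topology on $C$ is the one inherited from $E$. Let $\mathcal P(C)$ be the set of Borel probability measures on $C$. For $\mu,\nu\in\mathcal P(C)$ write $\mu\le\nu$ (stochastic order) if $\mu(U)\le\nu(U)$ for every open $U\subset C$ that is an upper set, i.e. such that $x\in U$, $y\in C$ and $x\le y$ imply $y\in U$. For $1\le p<\infty$ let $\mathcal P^p(C)$ be the set of $\mu\in\mathcal P(C)$ with $\int_C d_T(x,y)^p\,d\mu(y)<\infty$ for every $x\in C$ (equivalently, for some $x\in C$), and let $$d_p^W(\mu,\nu)=\Bigl[\inf_{\pi}\int_{C\times C}d_T(x,y)^p\,d\pi(x,y)\Bigr]^{1/p},$$ where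 $\pi$ runs over all Borel probability measures on $C\times C$ with marginals $\mu$ and $\nu$. Let $1\le p<\infty$ and $\mu_n,\nu\in\mathcal P^p(C)$ for $n\in\mathbb N$. (1) If $\mu_1\le\mu_2\le\cdots\le\nu$, then there exists $\mu\in\mathcal P^p(C)$ such that $\mu_n\le\mu\le\nu$ for all $n$ and $d_p^W(\mu_n,\mu)\to0$. (2) If $\mu_1\ge\mu_2\ge\cdots\ge\nu$, then there exists $\mu\in\mathcal P^p(C)$ such that $\mu_n\ge\mu\ge\nu$ for all $n$ and $d_p^W(\mu_n,\mu)\to0$. -/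

import Mathlib

open Filter Topology MeasureTheory
open scoped ENNReal

noncomputable section

namespace StochOrder

section Cone

variable {E : Type*} [NormedAddCommGroup E] [NormedSpace ℝ E]

/-- The closure of the cone `C` is a proper cone: it meets its negative only in `0`. -/
def ClosureProper (C : ConvexCone ℝ E) : Prop :=
  ∀ x : E, x ∈ closure (C : Set E) → -x ∈ closure (C : Set E) → x = 0

/-- The order defined by the closed cone: `x ≤ y` iff `y - x` lies in the closure of `C`. -/
def coneLE (C : ConvexCone ℝ E) (x y : E) : Prop :=
  y - x ∈ closure (C : Set E)

/-- `M(x/y) = inf {t > 0 : x ≤ t y}`. -/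
def coneGauge (C : ConvexCone ℝ E) (x y : E) : ℝ :=
  sInf {t : ℝ | 0 < t ∧ coneLE C x (t • y)}

/-- The Thompson part metric on the open cone,
`d_T(x,y) = max (log M(x/y)) (log M(y/x))`. -/
def thompson (C : ConvexCone ℝ E) (x y : {x : E // x ∈ C}) : ℝ :=
  max (Real.log (coneGauge C (x : E) (y : E))) (Real.log (coneGauge C (y : E) (x : E)))

end Cone

section Measures

variable {X : Type*} [MeasurableSpace X]

/-- The stochastic order for a relation `r` (the partial order of `X`): `μ ≤ ν` iff
`μ U ≤ ν U` for every open upper set `U`. -/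
def StochLE [TopologicalSpace X] (r : X → X → Prop) (μ ν : ProbabilityMeasure X) : Prop :=
  ∀ U : Set X, IsOpen U → (∀ x ∈ U, ∀ y, r x y → y ∈ U) →
    (μ : Measure X) U ≤ (ν : Measure X) U

/-- `μ` has finite `p`-th moment with respect to the distance function `d`. -/
def FiniteMoment (d : X → X → ℝ) (p : ℝ) (μ : ProbabilityMeasure X) : Prop :=
  ∀ x : X, ∫⁻ y, ENNReal.ofReal (d x y ^ p) ∂(μ : Measure X) < ∞

/-- `π` is a coupling of `μ` and `ν`: its marginals are `μ` and `ν`. -/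
def IsCoupling (π : ProbabilityMeasure (X × X)) (μ ν : ProbabilityMeasure X) : Prop :=
  (π : Measure (X × X)).map Prod.fst = (μ : Measure X) ∧
    (π : Measure (X × X)).map Prod.snd = (ν : Measure X)

/-- The `p`-Wasserstein distance for the distance function `d`, with values in `[0,∞]`. -/
def wasserstein (d : X → X → ℝ) (p : ℝ) (μ ν : ProbabilityMeasure X) : ℝ≥0∞ :=
  (⨅ (π : ProbabilityMeasure (X × X)) (_ : IsCoupling π μ ν),
    ∫⁻ z, ENNReal.ofReal (d z.1 z.2 ^ p) ∂(π : Measure (X × X))) ^ (1 / p)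

end Measures

section ConeMeasures

variable {E : Type*} [NormedAddCommGroup E] [NormedSpace ℝ E] [MeasurableSpace E]

/-- The stochastic order on the Borel probability measures on the open cone `C`. -/
def coneStochLE (C : ConvexCone ℝ E) (μ ν : ProbabilityMeasure {x : E // x ∈ C}) : Prop :=
  StochLE (fun x y : {x : E // x ∈ C} => coneLE C (x : E) (y : E)) μ ν

/-- The set of Borel probability measures on `C` with finite `p`-th moment for the
Thompson metric. -/
def Pp (C : ConvexCone ℝ E) (p : ℝ) : Set (ProbabilityMeasure {x : E // x ∈ C}) :=
  {μ | FiniteMoment (thompson C) p μ}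

/-- The `p`-Wasserstein metric on measures on `C` arising from the Thompson metric. -/
def coneWasserstein (C : ConvexCone ℝ E) (p : ℝ)
    (μ ν : ProbabilityMeasure {x : E // x ∈ C}) : ℝ≥0∞ :=
  wasserstein (thompson C) p μ ν

end ConeMeasures

end StochOrder

end

/-! A monotone sequence that is bounded in the stochastic order lies in an order interval between
two elements of `Pp`, and two facts about such intervals give the result. They are tight. The
Thompson ball of radius `R` about `e` is the order interval from `exp(-R)•e` to `exp(R)•e`, compact
because a closed proper cone in finite dimension is normal. Leaving the ball means leaving it
upwards (an open upper set, bounded by the upper measure) or downwards (the complement of an open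
upper set, bounded by the lower measure): `measure_lt_thompson_le`. The same tail bound, integrated
over levels, makes the `p`-th moments uniformly integrable: `lintegral_thompson_sub_le`. Tightness
provides weak cluster points. The order is closed under weak limits (`coneStochLE_of_tendsto`), so
by monotonicity any two cluster points are comparable both ways, and they coincide because open
upper sets form a π-system generating the Borel sets (`coneStochLE_antisymm`). Hence the sequence
converges weakly, and uniform integrability upgrades this to Wasserstein convergence by explicit
couplings (`tendsto_wasserstein_of_tendsto`). -/

open scoped NNReal

namespace StochOrder

/-! ### Construction of couplings from partial ones. -/

section Coupling

variable {X : Type*} [MeasurableSpace X]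

/-- A measure on the product whose marginals are below `α` and `β` extends to a coupling, by adding
a multiple of the product of what is left of the marginals. -/
theorem exists_coupling_of_marginals_le (α β : ProbabilityMeasure X) (τ : Measure (X × X))
    (h₁ : τ.map Prod.fst ≤ (α : Measure X)) (h₂ : τ.map Prod.snd ≤ (β : Measure X))
    {c : X × X → ℝ≥0∞} {F : X → ℝ≥0∞} (hF : Measurable F)
    (hc : ∀ z, c z ≤ F z.1 + F z.2) :
    ∃ π : ProbabilityMeasure (X × X), IsCoupling π α β ∧
      ∫⁻ z, c z ∂(π : Measure (X × X)) ≤ ∫⁻ z, c z ∂τ +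
        (∫⁻ x, F x ∂((α : Measure X) - τ.map Prod.fst) +
          ∫⁻ x, F x ∂((β : Measure X) - τ.map Prod.snd)) := by
  have hτ1 : τ.map Prod.fst Set.univ = τ Set.univ := by
    rw [Measure.map_apply measurable_fst MeasurableSet.univ, Set.preimage_univ]
  have hτ2 : τ.map Prod.snd Set.univ = τ Set.univ := by
    rw [Measure.map_apply measurable_snd MeasurableSet.univ, Set.preimage_univ]
  set γ₁ := τ.map Prod.fst with hγ₁
  set γ₂ := τ.map Prod.snd with hγ₂
  have : IsFiniteMeasure γ₁ := isFiniteMeasure_of_le _ h₁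
  have : IsFiniteMeasure γ₂ := isFiniteMeasure_of_le _ h₂
  have e₁ : (α : Measure X) - γ₁ + γ₁ = α := Measure.sub_add_cancel_of_le h₁
  have e₂ : (β : Measure X) - γ₂ + γ₂ = β := Measure.sub_add_cancel_of_le h₂
  have m₁ : ((α : Measure X) - γ₁) Set.univ = 1 - τ Set.univ := by
    rw [Measure.sub_apply MeasurableSet.univ h₁, hτ1, measure_univ]
  have m₂ : ((β : Measure X) - γ₂) Set.univ = 1 - τ Set.univ := by
    rw [Measure.sub_apply MeasurableSet.univ h₂, hτ2, measure_univ]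
  have : IsFiniteMeasure ((α : Measure X) - γ₁) := isFiniteMeasure_of_le _ Measure.sub_le
  have : IsFiniteMeasure ((β : Measure X) - γ₂) := isFiniteMeasure_of_le _ Measure.sub_le
  set ρ₁ := (α : Measure X) - γ₁
  set ρ₂ := (β : Measure X) - γ₂
  -- Both remainders have the same total mass `r`, so `r⁻¹ • ρ₁.prod ρ₂` has marginals `ρ₁` and
  -- `ρ₂`. If `r = 0`, then `r⁻¹ = ∞`, but both remainders vanish.
  set r := 1 - τ Set.univ with hr
  have hrtop : r ≠ ∞ := ne_top_of_le_ne_top ENNReal.one_ne_top tsub_le_self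
  have c₁ : (r⁻¹ • ρ₁.prod ρ₂).map Prod.fst = ρ₁ := by
    rw [Measure.map_smul, Measure.map_fst_prod, m₂, smul_smul]
    by_cases h : r = 0
    · rw [h] at m₁
      rw [Measure.measure_univ_eq_zero.mp m₁, smul_zero]
    · rw [ENNReal.inv_mul_cancel h hrtop, one_smul]
  have c₂ : (r⁻¹ • ρ₁.prod ρ₂).map Prod.snd = ρ₂ := by
    rw [Measure.map_smul, Measure.map_snd_prod, m₁, smul_smul]
    by_cases h : r = 0
    · rw [h] at m₂
      rw [Measure.measure_univ_eq_zero.mp m₂, smul_zero]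
    · rw [ENNReal.inv_mul_cancel h hrtop, one_smul]
  have M₁ : (τ + r⁻¹ • ρ₁.prod ρ₂).map Prod.fst = (α : Measure X) := by
    rw [Measure.map_add _ _ measurable_fst, c₁, add_comm, ← hγ₁, e₁]
  have M₂ : (τ + r⁻¹ • ρ₁.prod ρ₂).map Prod.snd = (β : Measure X) := by
    rw [Measure.map_add _ _ measurable_snd, c₂, add_comm, ← hγ₂, e₂]
  refine ⟨⟨τ + r⁻¹ • ρ₁.prod ρ₂, ⟨?_⟩⟩, ⟨M₁, M₂⟩, ?_⟩
  · have := Measure.map_apply (μ := τ + r⁻¹ • ρ₁.prod ρ₂) measurable_fst MeasurableSet.univ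
    rw [Set.preimage_univ, M₁, measure_univ] at this
    exact this.symm
  · change ∫⁻ z, c z ∂(τ + r⁻¹ • ρ₁.prod ρ₂) ≤ _
    rw [lintegral_add_measure]
    refine add_le_add_right ?_ _
    calc ∫⁻ z, c z ∂(r⁻¹ • ρ₁.prod ρ₂)
        ≤ ∫⁻ z, (F z.1 + F z.2) ∂(r⁻¹ • ρ₁.prod ρ₂) := lintegral_mono hc
      _ = ∫⁻ x, F x ∂((r⁻¹ • ρ₁.prod ρ₂).map Prod.fst) +
          ∫⁻ x, F x ∂((r⁻¹ • ρ₁.prod ρ₂).map Prod.snd) := by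
        rw [lintegral_add_left (f := fun z : X × X => F z.1) (hF.comp measurable_fst), lintegral_map hF measurable_fst,
          lintegral_map hF measurable_snd]
      _ = _ := by rw [c₁, c₂]

theorem min_div_mul_mul_le_one (a b : ℝ≥0∞) (hb : b ≠ ∞) : min a b / (a * b) * b ≤ 1 := by
  rcases eq_or_ne b 0 with rfl | hb0
  · simp
  rcases eq_or_ne a 0 with rfl | ha0
  · simp
  calc min a b / (a * b) * b ≤ a / (a * b) * b := by gcongr; exact min_le_left _ _
    _ = a * b / (a * b) := by rw [ENNReal.div_eq_inv_mul, ENNReal.div_eq_inv_mul, mul_assoc]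
    _ ≤ 1 := ENNReal.div_self_le_one

theorem min_div_mul_mul_mul (a b : ℝ≥0∞) (ha : a ≠ ∞) (hb : b ≠ ∞) :
    min a b / (a * b) * (a * b) = min a b := by
  rcases eq_or_ne b 0 with rfl | hb0
  · simp
  rcases eq_or_ne a 0 with rfl | ha0
  · simp
  exact ENNReal.div_mul_cancel (mul_ne_zero ha0 hb0) (ENNReal.mul_ne_top ha hb)

/-- Coupling adapted to a finite family of disjoint sets: inside each set as much mass as possible
is coupled, the rest is coupled independently. -/
theorem exists_coupling_of_disjoint {ι : Type*} (s : Finset ι) (A : ι → Set X)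
    (hA : ∀ i, MeasurableSet (A i)) (hdisj : Pairwise (Function.onFun Disjoint A))
    (α β : ProbabilityMeasure X) {c : X × X → ℝ≥0∞} {F G : X → ℝ≥0∞} {K κ R : ℝ≥0∞}
    (hF : Measurable F)
    (hcF : ∀ z, c z ≤ K * (F z.1 + F z.2)) (hκ : ∀ i, ∀ z ∈ A i ×ˢ A i, c z ≤ κ)
    (hFG : ∀ x, F x ≤ R + G x) :
    ∃ π : ProbabilityMeasure (X × X), IsCoupling π α β ∧
      ∫⁻ z, c z ∂(π : Measure (X × X)) ≤ κ +
        K * (2 * (R * (1 - ∑ i ∈ s, min ((α : Measure X) (A i)) ((β : Measure X) (A i)))) +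
          (∫⁻ x, G x ∂(α : Measure X) + ∫⁻ x, G x ∂(β : Measure X))) := by
  set a : ι → ℝ≥0∞ := fun i => (α : Measure X) (A i)
  set b : ι → ℝ≥0∞ := fun i => (β : Measure X) (A i)
  have ha : ∀ i, a i ≠ ∞ := fun i => measure_ne_top _ _
  have hb : ∀ i, b i ≠ ∞ := fun i => measure_ne_top _ _
  -- The weight gives the `i`-th block total mass `min (a i) (b i)`, the most that both marginals
  -- allow. An empty block is harmless, since `0 / 0 = 0` in `ℝ≥0∞`.
  set τ : Measure (X × X) := ∑ i ∈ s, (min (a i) (b i) / (a i * b i)) •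
    ((α : Measure X).restrict (A i)).prod ((β : Measure X).restrict (A i)) with hτ
  have restr_le : ∀ (σ : Measure X), ∑ i ∈ s, σ.restrict (A i) ≤ σ := by
    intro σ
    refine Measure.le_iff.2 fun t ht => ?_
    rw [Measure.finsetSum_apply]
    simp_rw [Measure.restrict_apply ht]
    rw [← measure_biUnion_finset (fun i _ j _ hij =>
      (hdisj hij).mono Set.inter_subset_right Set.inter_subset_right) (fun i _ => ht.inter (hA i))]
    exact measure_mono (Set.iUnion₂_subset fun i _ => Set.inter_subset_left)
  have smul_le : ∀ (k : ℝ≥0∞) (σ : Measure X), k ≤ 1 → k • σ ≤ σ := by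
    intro k σ hk
    refine Measure.le_iff.2 fun t _ => ?_
    rw [Measure.smul_apply, smul_eq_mul]
    exact mul_le_of_le_one_left' hk
  have fst_le : τ.map Prod.fst ≤ (α : Measure X) := by
    refine le_trans ?_ (restr_le _)
    rw [hτ, ← Measure.mapₗ_apply_of_measurable measurable_fst, map_sum]
    refine Finset.sum_le_sum fun i _ => ?_
    rw [Measure.mapₗ_apply_of_measurable measurable_fst, Measure.map_smul, Measure.map_fst_prod,
      Measure.restrict_apply_univ, smul_smul]
    exact smul_le _ _ (min_div_mul_mul_le_one _ _ (hb i))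
  have snd_le : τ.map Prod.snd ≤ (β : Measure X) := by
    refine le_trans ?_ (restr_le _)
    rw [hτ, ← Measure.mapₗ_apply_of_measurable measurable_snd, map_sum]
    refine Finset.sum_le_sum fun i _ => ?_
    rw [Measure.mapₗ_apply_of_measurable measurable_snd, Measure.map_smul, Measure.map_snd_prod,
      Measure.restrict_apply_univ, smul_smul]
    refine smul_le _ _ ?_
    rw [min_comm, mul_comm (a i)]
    exact min_div_mul_mul_le_one _ _ (ha i)
  have τ_univ : τ Set.univ = ∑ i ∈ s, min (a i) (b i) := by
    rw [hτ, Measure.finsetSum_apply]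
    refine Finset.sum_congr rfl fun i _ => ?_
    rw [Measure.smul_apply, ← Set.univ_prod_univ, Measure.prod_prod, Measure.restrict_apply_univ,
      Measure.restrict_apply_univ, smul_eq_mul]
    exact min_div_mul_mul_mul _ _ (ha i) (hb i)
  have sum_le : ∑ i ∈ s, min (a i) (b i) ≤ 1 := by
    calc ∑ i ∈ s, min (a i) (b i) ≤ ∑ i ∈ s, (α : Measure X).restrict (A i) Set.univ :=
          Finset.sum_le_sum fun i _ => by
            rw [Measure.restrict_apply_univ]; exact min_le_left _ _
      _ = (∑ i ∈ s, (α : Measure X).restrict (A i)) Set.univ := by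
          rw [Measure.finsetSum_apply]
      _ ≤ 1 := (restr_le _ _).trans (by simp)
  have int_τ : ∫⁻ z, c z ∂τ ≤ κ := by
    calc ∫⁻ z, c z ∂τ
        = ∑ i ∈ s, (min (a i) (b i) / (a i * b i)) * ∫⁻ z, c z ∂
            ((α : Measure X).restrict (A i)).prod ((β : Measure X).restrict (A i)) := by
          rw [hτ, lintegral_finsetSum_measure]
          simp_rw [lintegral_smul_measure, smul_eq_mul]
      _ ≤ ∑ i ∈ s, (min (a i) (b i) / (a i * b i)) * (κ * (a i * b i)) := by
          refine Finset.sum_le_sum fun i _ => ?_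
          gcongr
          rw [Measure.prod_restrict]
          calc ∫⁻ z in A i ×ˢ A i, c z ∂((α : Measure X).prod (β : Measure X))
              ≤ ∫⁻ z in A i ×ˢ A i, κ ∂((α : Measure X).prod (β : Measure X)) :=
                setLIntegral_mono' ((hA i).prod (hA i)) (hκ i)
            _ = κ * (a i * b i) := by
                rw [lintegral_const, Measure.restrict_apply_univ, Measure.prod_prod]
      _ = κ * ∑ i ∈ s, min (a i) (b i) := by
          rw [Finset.mul_sum]
          refine Finset.sum_congr rfl fun i _ => ?_
          rw [mul_left_comm, min_div_mul_mul_mul _ _ (ha i) (hb i)]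
      _ ≤ κ := mul_le_of_le_one_right' sum_le
  -- The uncoupled part costs at most `R` per unit of its small mass, plus the tail `G`, which is
  -- integrated against all of `σ`.
  have rest : ∀ (σ : ProbabilityMeasure X) (γ : Measure X), γ ≤ (σ : Measure X) →
      γ Set.univ = ∑ i ∈ s, min (a i) (b i) →
      ∫⁻ x, K * F x ∂((σ : Measure X) - γ) ≤
        K * (R * (1 - ∑ i ∈ s, min (a i) (b i)) + ∫⁻ x, G x ∂(σ : Measure X)) := by
    intro σ γ hγ hm
    have : IsFiniteMeasure γ := isFiniteMeasure_of_le _ hγ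
    rw [lintegral_const_mul _ hF]
    gcongr
    calc ∫⁻ x, F x ∂((σ : Measure X) - γ) ≤ ∫⁻ x, (R + G x) ∂((σ : Measure X) - γ) :=
          lintegral_mono hFG
      _ = R * (1 - ∑ i ∈ s, min (a i) (b i)) + ∫⁻ x, G x ∂((σ : Measure X) - γ) := by
          rw [lintegral_add_left measurable_const, lintegral_const,
            Measure.sub_apply MeasurableSet.univ hγ, hm, measure_univ]
      _ ≤ _ := by gcongr; exact Measure.sub_le
  obtain ⟨π, hπ, hle⟩ := exists_coupling_of_marginals_le α β τ fst_le snd_le (c := c)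
    (F := fun x => K * F x) (hF.const_mul K) (fun z => (hcF z).trans_eq (mul_add _ _ _))
  refine ⟨π, hπ, hle.trans ?_⟩
  have r₁ := rest α _ fst_le (by
    rw [Measure.map_apply measurable_fst MeasurableSet.univ, Set.preimage_univ, τ_univ])
  have r₂ := rest β _ snd_le (by
    rw [Measure.map_apply measurable_snd MeasurableSet.univ, Set.preimage_univ, τ_univ])
  refine add_le_add int_τ ((add_le_add r₁ r₂).trans_eq ?_)
  ring

end Coupling

/-! ### From weak convergence to Wasserstein convergence. -/

section Wasserstein

variable {X : Type*} [TopologicalSpace X] [MeasurableSpace X]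

theorem measure_frontier_diff_eq_zero {μ : Measure X} {s t : Set X} (hs : μ (frontier s) = 0)
    (ht : μ (frontier t) = 0) : μ (frontier (s \ t)) = 0 := by
  refine measure_mono_null (t := frontier s ∪ frontier t) ?_ (measure_union_null hs ht)
  rw [Set.sdiff_eq]
  refine (frontier_inter_subset s tᶜ).trans ?_
  rw [frontier_compl]
  exact Set.union_subset_union Set.inter_subset_left Set.inter_subset_right

/-- The level sets of `g` are disjoint, so only countably many carry mass, while every interval of
radii is uncountable. -/
theorem exists_measure_frontier_sublevel_eq_zero [OpensMeasurableSpace X] (μ : Measure X) [SFinite μ] {g : X → ℝ}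
    (hg : Continuous g) {r : ℝ} (hr : 0 < r) :
    ∃ t, 0 < t ∧ t < r ∧ μ (frontier {x | g x < t}) = 0 := by
  have key := Measure.countable_meas_level_set_pos (μ := μ) hg.measurable
  have : ¬ (Set.Ioo 0 r ⊆ {t : ℝ | 0 < μ {a : X | g a = t}}) := fun h =>
    (Cardinal.Real.Ioo_countable_iff.not.mpr (not_le.mpr hr)) (key.mono h)
  obtain ⟨t, ht, h⟩ := Set.not_subset.mp this
  refine ⟨t, ht.1, ht.2, measure_mono_null (frontier_lt_subset_eq hg continuous_const) ?_⟩
  simpa using h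

/-- Weak convergence together with uniform integrability of the `p`-th moments implies
convergence in the `p`-Wasserstein distance of a continuous pseudo-distance. -/
theorem tendsto_wasserstein_of_tendsto [OpensMeasurableSpace X] [SecondCountableTopology X] [HasOuterApproxClosed X]
    {d : X → X → ℝ} (hd : Continuous fun z : X × X => d z.1 z.2) (hnn : ∀ x y, 0 ≤ d x y)
    (hself : ∀ x, d x x = 0) (hsymm : ∀ x y, d x y = d y x)
    (htri : ∀ x y z, d x z ≤ d x y + d y z) {p : ℝ} (hp : 1 ≤ p)
    {σ : ℕ → ProbabilityMeasure X} {σ₀ : ProbabilityMeasure X}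
    (hσ : Tendsto σ atTop (𝓝 σ₀)) (e : X)
    (hUI : ∀ δ : ℝ≥0∞, 0 < δ → ∃ R : ℝ≥0,
      (∀ n, ∫⁻ x, (ENNReal.ofReal (d e x ^ p) - R) ∂(σ n : Measure X) ≤ δ) ∧
      ∫⁻ x, (ENNReal.ofReal (d e x ^ p) - R) ∂(σ₀ : Measure X) ≤ δ) :
    Tendsto (fun n => wasserstein d p (σ n) σ₀) atTop (𝓝 0) := by
  have hp0 : 0 < p := lt_of_lt_of_le one_pos hp
  have hdx : ∀ x, Continuous (d x) := fun x => hd.comp (by fun_prop : Continuous fun y => (x, y))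
  have hFm : Measurable fun x => ENNReal.ofReal (d e x ^ p) :=
    (((hdx e).measurable).pow_const p).ennreal_ofReal
  -- The convexity constant in `(a + b)^p ≤ 2^(p-1) (a^p + b^p)`.
  set K : ℝ≥0∞ := 2 ^ (p - 1) with hK
  have hKtop : K ≠ ∞ := ENNReal.rpow_ne_top_of_nonneg (by linarith) ENNReal.ofNat_ne_top
  have hcF : ∀ z : X × X, ENNReal.ofReal (d z.1 z.2 ^ p) ≤
      K * (ENNReal.ofReal (d e z.1 ^ p) + ENNReal.ofReal (d e z.2 ^ p)) := by
    intro z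
    calc ENNReal.ofReal (d z.1 z.2 ^ p) ≤ ENNReal.ofReal ((d e z.1 + d e z.2) ^ p) := by
          refine ENNReal.ofReal_le_ofReal (Real.rpow_le_rpow (hnn _ _) ?_ hp0.le)
          have := htri z.1 e z.2
          rwa [hsymm z.1 e] at this
      _ = (ENNReal.ofReal (d e z.1) + ENNReal.ofReal (d e z.2)) ^ p := by
          rw [← ENNReal.ofReal_add (hnn _ _) (hnn _ _),
            ENNReal.ofReal_rpow_of_nonneg (add_nonneg (hnn _ _) (hnn _ _)) hp0.le]
      _ ≤ K * (ENNReal.ofReal (d e z.1) ^ p + ENNReal.ofReal (d e z.2) ^ p) :=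
          ENNReal.rpow_add_le_mul_rpow_add_rpow _ _ hp
      _ = _ := by
          rw [ENNReal.ofReal_rpow_of_nonneg (hnn _ _) hp0.le,
            ENNReal.ofReal_rpow_of_nonneg (hnn _ _) hp0.le]
  suffices h : Tendsto (fun n => ⨅ (π : ProbabilityMeasure (X × X)) (_ : IsCoupling π (σ n) σ₀),
      ∫⁻ z, ENNReal.ofReal (d z.1 z.2 ^ p) ∂(π : Measure (X × X))) atTop (𝓝 0) by
    have := ((ENNReal.continuous_rpow_const (y := 1 / p)).tendsto 0).comp h
    rwa [ENNReal.zero_rpow_of_pos (by positivity)] at this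
  rw [ENNReal.tendsto_nhds_zero]
  intro ε hε
  rcases eq_or_ne ε ∞ with rfl | hεtop
  · simp
  have h3 : 0 < ε / 3 := ENNReal.div_pos hε.ne' (by simp)
  obtain ⟨r, hr, hrε⟩ : ∃ r : ℝ, 0 < r ∧ ENNReal.ofReal ((2 * r) ^ p) ≤ ε / 3 := by
    have : Tendsto (fun r : ℝ => ENNReal.ofReal ((2 * r) ^ p)) (𝓝[>] 0) (𝓝 0) := by
      have h : Continuous fun r : ℝ => ENNReal.ofReal ((2 * r) ^ p) :=
        ENNReal.continuous_ofReal.comp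
          ((Real.continuous_rpow_const hp0.le).comp (continuous_const.mul continuous_id))
      have := h.tendsto 0
      simp only [mul_zero, Real.zero_rpow hp0.ne', ENNReal.ofReal_zero] at this
      exact this.mono_left nhdsWithin_le_nhds
    obtain ⟨r, hr, hr'⟩ := (((ENNReal.tendsto_nhds_zero.mp this) _ h3).and
      self_mem_nhdsWithin).exists
    exact ⟨r, hr', hr⟩
  have hδ : 0 < ε / 3 / (2 * K) :=
    ENNReal.div_pos h3.ne' (ENNReal.mul_ne_top (by simp) hKtop)
  obtain ⟨R, hR, hR₀⟩ := hUI _ hδ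
  -- Space is cut into countably many pieces of diameter at most `2r` with `σ₀`-null frontier, so
  -- that weak convergence gives convergence of the mass of each piece.
  choose t ht0 htr htf using fun x : X =>
    exists_measure_frontier_sublevel_eq_zero (σ₀ : Measure X) (hdx x) hr
  obtain ⟨S, hS, hSU⟩ := TopologicalSpace.countable_cover_nhds (f := fun x => {y | d x y < t x})
    fun x => (isOpen_lt (hdx x) continuous_const).mem_nhds (by simpa [hself] using ht0 x)
  have hSne : S.Nonempty := by
    by_contra h
    rw [Set.not_nonempty_iff_eq_empty] at h
    rw [h] at hSU
    simpa using hSU.ge (Set.mem_univ e)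
  obtain ⟨u, rfl⟩ := hS.exists_eq_range hSne
  set B : ℕ → Set X := fun k => {y | d (u k) y < t (u k)} with hB
  have hBm : ∀ k, MeasurableSet (B k) := fun k =>
    (isOpen_lt (hdx _) continuous_const).measurableSet
  have hBU : ⋃ k, B k = Set.univ := by rw [← hSU, Set.biUnion_range]
  set A := disjointed B with hA
  have hAm : ∀ k, MeasurableSet (A k) := fun k => MeasurableSet.disjointed hBm k
  have hAf : ∀ k, (σ₀ : Measure X) (frontier (A k)) = 0 := fun k =>
    disjointedRec (p := fun s => (σ₀ : Measure X) (frontier s) = 0)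
      (fun _ i hs => measure_frontier_diff_eq_zero hs (htf (u i))) (htf (u k))
  have hsum : Tendsto (fun m => ∑ k ∈ Finset.range m, (σ₀ : Measure X) (A k)) atTop (𝓝 1) := by
    have h1 : ∑' k, (σ₀ : Measure X) (A k) = 1 := by
      rw [← measure_iUnion (disjoint_disjointed B) hAm, iUnion_disjointed, hBU, measure_univ]
    rw [← h1]
    exact ENNReal.summable.hasSum.tendsto_sum_nat
  have hφ : Tendsto (fun w : ℝ≥0∞ => K * (2 * (R * (1 - w)))) (𝓝 1) (𝓝 0) := by
    have h1 : Tendsto (fun w : ℝ≥0∞ => 1 - w) (𝓝 1) (𝓝 0) := by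
      have := ENNReal.Tendsto.sub (tendsto_const_nhds (x := (1 : ℝ≥0∞)) (f := 𝓝 (1 : ℝ≥0∞)))
        tendsto_id (Or.inl ENNReal.one_ne_top)
      simpa using this
    have h2 := ENNReal.Tendsto.const_mul h1 (Or.inr (ENNReal.coe_ne_top (r := R)))
    have h3 := ENNReal.Tendsto.const_mul h2 (Or.inr (ENNReal.ofNat_ne_top (n := 2)))
    have h4 := ENNReal.Tendsto.const_mul h3 (Or.inr hKtop)
    simpa using h4
  have hφ' := hφ.eventually (gt_mem_nhds h3)
  -- The bound is needed in a whole neighbourhood of the partial sum, because the coupled masses for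
  -- `σ n` only converge to it.
  obtain ⟨m, hm⟩ := (hsum.eventually (eventually_eventually_nhds.mpr hφ')).exists
  have hmin : Tendsto (fun n => ∑ k ∈ Finset.range m,
      min ((σ n : Measure X) (A k)) ((σ₀ : Measure X) (A k))) atTop
      (𝓝 (∑ k ∈ Finset.range m, (σ₀ : Measure X) (A k))) := by
    refine tendsto_finsetSum _ fun k _ => ?_
    have := (ProbabilityMeasure.tendsto_measure_of_null_frontier_of_tendsto' hσ (hAf k)).min
      (tendsto_const_nhds (x := (σ₀ : Measure X) (A k)))
    rwa [min_self] at this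
  filter_upwards [hmin.eventually hm] with n hn
  obtain ⟨π, hπ, hle⟩ := exists_coupling_of_disjoint (Finset.range m) A hAm (disjoint_disjointed B)
    (σ n) σ₀ (c := fun z => ENNReal.ofReal (d z.1 z.2 ^ p)) (K := K) (κ := ε / 3) (R := R)
    (G := fun x => ENNReal.ofReal (d e x ^ p) - R) hFm hcF (by
      rintro i ⟨x, y⟩ ⟨hx, hy⟩
      refine le_trans (ENNReal.ofReal_le_ofReal (Real.rpow_le_rpow (hnn _ _) ?_ hp0.le)) hrε
      have hx' : d (u i) x < t (u i) := disjointed_subset B i hx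
      have hy' : d (u i) y < t (u i) := disjointed_subset B i hy
      have h1 := htri x (u i) y
      rw [hsymm x (u i)] at h1
      have h2 := htr (u i)
      change d x y ≤ 2 * r
      linarith) (fun x => le_add_tsub)
  refine (iInf₂_le π hπ).trans (hle.trans ?_)
  have hG : K * (∫⁻ x, (ENNReal.ofReal (d e x ^ p) - R) ∂(σ n : Measure X) +
      ∫⁻ x, (ENNReal.ofReal (d e x ^ p) - R) ∂(σ₀ : Measure X)) ≤ ε / 3 := by
    calc _ ≤ K * (ε / 3 / (2 * K) + ε / 3 / (2 * K)) := by gcongr; exact hR n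
      _ = (2 * K) * (ε / 3 / (2 * K)) := by ring
      _ ≤ ε / 3 := ENNReal.mul_div_le
  rw [mul_add]
  -- The thirds are the cost inside the pieces, the uncoupled mass times `R`, and the tails above
  -- `R`.
  calc _ ≤ ε / 3 + (ε / 3 + ε / 3) := by gcongr
    _ = ε := by rw [← add_assoc, ENNReal.add_thirds]

end Wasserstein

/-! ### The cone order and the Thompson metric. -/

section ConeGeometry

variable {E : Type*} [NormedAddCommGroup E] [NormedSpace ℝ E] {C : ConvexCone ℝ E}

theorem closure_add_mem {x y : E} (hx : x ∈ closure (C : Set E)) (hy : y ∈ closure (C : Set E)) :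
    x + y ∈ closure (C : Set E) :=
  C.closure.add_mem hx hy

theorem closure_smul_mem {t : ℝ} (ht : 0 < t) {x : E} (hx : x ∈ closure (C : Set E)) :
    t • x ∈ closure (C : Set E) :=
  C.closure.smul_mem ht hx

theorem add_mem_of_mem_closure (hCo : IsOpen (C : Set E)) {x k : E} (hx : x ∈ C)
    (hk : k ∈ closure (C : Set E)) : x + k ∈ C := by
  have hO : IsOpen {u : E | x + (k - u) ∈ C} := hCo.preimage (by fun_prop)
  -- Replace `k` by a nearby `u` in `C`; the error `k - u` is absorbed by the interior point `x`.
  obtain ⟨u, hu, huC⟩ := mem_closure_iff.mp hk _ hO (by simpa using hx)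
  have : x + k = (x + (k - u)) + u := by abel
  rw [this]
  exact C.add_mem hu huC

theorem exists_add_smul_mem (hCo : IsOpen (C : Set E)) {x : E} (hx : x ∈ C) (v : E) :
    ∃ ε : ℝ, 0 < ε ∧ x + ε • v ∈ C := by
  have hc : Continuous fun ε : ℝ => x + ε • v := by fun_prop
  have h : ∀ᶠ ε in 𝓝 (0 : ℝ), x + ε • v ∈ C :=
    (hCo.preimage hc).mem_nhds (by simpa using hx)
  obtain ⟨ε, hε, h0⟩ := ((h.filter_mono nhdsWithin_le_nhds).and
    (self_mem_nhdsWithin (s := Set.Ioi (0 : ℝ)))).exists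
  exact ⟨ε, h0, hε⟩

theorem zero_mem_closure {x : E} (hx : x ∈ C) : (0 : E) ∈ closure (C : Set E) := by
  have hc : Continuous fun ε : ℝ => ε • x := by fun_prop
  have h : Tendsto (fun ε : ℝ => ε • x) (𝓝[>] 0) (𝓝 0) := by
    have := hc.tendsto 0
    rw [zero_smul] at this
    exact this.mono_left nhdsWithin_le_nhds
  refine mem_closure_of_tendsto h ?_
  filter_upwards [self_mem_nhdsWithin] with ε hε using C.smul_mem hε hx

theorem ClosureProper.subsingleton_of_zero_mem (hC : ClosureProper C) (hCo : IsOpen (C : Set E))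
    (h0 : (0 : E) ∈ C) : Subsingleton E := by
  have key : ∀ v : E, v ∈ closure (C : Set E) := by
    intro v
    obtain ⟨ε, hε, h⟩ := exists_add_smul_mem hCo h0 v
    have h1 := C.smul_mem (inv_pos.mpr hε) h
    rw [zero_add, smul_smul, inv_mul_cancel₀ hε.ne', one_smul] at h1
    exact subset_closure h1
  exact ⟨fun a b => sub_eq_zero.mp (hC _ (key _) (key _))⟩

theorem coneLE.trans {x y z : E} (hxy : coneLE C x y) (hyz : coneLE C y z) : coneLE C x z := by
  have := closure_add_mem hyz hxy
  rwa [sub_add_sub_cancel] at this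

theorem coneLE.smul {x y : E} {t : ℝ} (ht : 0 < t) (h : coneLE C x y) :
    coneLE C (t • x) (t • y) := by
  have := closure_smul_mem ht h
  rwa [smul_sub] at this

theorem coneLE_refl {x y : E} (hx : x ∈ C) : coneLE C y y := by
  rw [coneLE, sub_self]
  exact zero_mem_closure hx

theorem coneLE_smul_smul {y : E} (hy : y ∈ C) {s t : ℝ} (hst : s ≤ t) :
    coneLE C (s • y) (t • y) := by
  rcases hst.eq_or_lt with rfl | h
  · exact coneLE_refl hy
  · rw [coneLE, ← sub_smul]
    exact closure_smul_mem (sub_pos.mpr h) (subset_closure hy)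

theorem isClosed_coneLE (C : ConvexCone ℝ E) : IsClosed {z : E × E | coneLE C z.1 z.2} :=
  isClosed_closure.preimage (by fun_prop : Continuous fun z : E × E => z.2 - z.1)

theorem coneLE_of_forall_lt {x y : E} {t : ℝ} (h : ∀ s, t < s → coneLE C x (s • y)) :
    coneLE C x (t • y) := by
  have hc : Continuous fun s : ℝ => (x, s • y) := by fun_prop
  refine (isClosed_coneLE C).mem_of_tendsto
    ((hc.tendsto t).mono_left (nhdsWithin_le_nhds (s := Set.Ioi t))) ?_
  filter_upwards [self_mem_nhdsWithin] with s hs using h s hs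

/-- Openness makes the set of admissible factors nonempty, so `sInf` is a genuine infimum;
closedness of the order lets the inequality pass to the limit. -/
theorem coneGauge_le_iff (hCo : IsOpen (C : Set E)) {x y : E} (hy : y ∈ C) {t : ℝ}
    (ht : 0 < t) : coneGauge C x y ≤ t ↔ coneLE C x (t • y) := by
  have hbdd : BddBelow {t : ℝ | 0 < t ∧ coneLE C x (t • y)} := ⟨0, fun _ h => h.1.le⟩
  refine ⟨fun h => coneLE_of_forall_lt fun s hs => ?_, fun h => csInf_le hbdd ⟨ht, h⟩⟩
  obtain ⟨ε, hε, hm⟩ := exists_add_smul_mem hCo hy (-x)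
  have hne : {t : ℝ | 0 < t ∧ coneLE C x (t • y)}.Nonempty := by
    refine ⟨ε⁻¹, inv_pos.mpr hε, ?_⟩
    have := closure_smul_mem (inv_pos.mpr hε) (subset_closure hm)
    rwa [smul_add, smul_smul, inv_mul_cancel₀ hε.ne', one_smul, ← sub_eq_add_neg] at this
  obtain ⟨r, hr, hrs⟩ := (csInf_lt_iff hbdd hne).mp (h.trans_lt hs)
  exact hr.2.trans (coneLE_smul_smul hy hrs.le)

theorem coneGauge_pos (hCo : IsOpen (C : Set E)) (hC : ClosureProper C) (h0 : (0 : E) ∉ C)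
    {x y : E} (hx : x ∈ C) (hy : y ∈ C) : 0 < coneGauge C x y := by
  by_contra! h
  have h1 : coneLE C x ((0 : ℝ) • y) :=
    coneLE_of_forall_lt fun s hs => (coneGauge_le_iff hCo hy hs).mp (h.trans hs.le)
  rw [coneLE, zero_smul, zero_sub] at h1
  exact h0 (hC x (subset_closure hx) h1 ▸ hx)

/-- Removes logarithms and infima: the metric properties below are all read off from these two order
inequalities. Positivity of the gauge, hence `0 ∉ C`, is what keeps `Real.log` away from its value
at `0`. -/
theorem thompson_le_iff (hCo : IsOpen (C : Set E)) (hC : ClosureProper C) (h0 : (0 : E) ∉ C)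
    (x y : {x : E // x ∈ C}) (s : ℝ) :
    thompson C x y ≤ s ↔
      coneLE C (x : E) (Real.exp s • (y : E)) ∧ coneLE C (y : E) (Real.exp s • (x : E)) := by
  rw [thompson, max_le_iff, Real.log_le_iff_le_exp (coneGauge_pos hCo hC h0 x.2 y.2),
    Real.log_le_iff_le_exp (coneGauge_pos hCo hC h0 y.2 x.2),
    coneGauge_le_iff hCo y.2 (Real.exp_pos s), coneGauge_le_iff hCo x.2 (Real.exp_pos s)]

theorem thompson_comm (x y : {x : E // x ∈ C}) : thompson C x y = thompson C y x :=
  max_comm _ _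

theorem coneLE_exp_trans {x y z : E} {s t : ℝ} (hxy : coneLE C x (Real.exp s • y))
    (hyz : coneLE C y (Real.exp t • z)) : coneLE C x (Real.exp (s + t) • z) := by
  have := hxy.trans (hyz.smul (Real.exp_pos s))
  rwa [smul_smul, ← Real.exp_add] at this

theorem thompson_triangle (hCo : IsOpen (C : Set E)) (hC : ClosureProper C) (h0 : (0 : E) ∉ C)
    (x y z : {x : E // x ∈ C}) : thompson C x z ≤ thompson C x y + thompson C y z := by
  have h1 := (thompson_le_iff hCo hC h0 x y _).mp le_rfl
  have h2 := (thompson_le_iff hCo hC h0 y z _).mp le_rfl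
  refine (thompson_le_iff hCo hC h0 x z _).mpr ⟨coneLE_exp_trans h1.1 h2.1, ?_⟩
  rw [add_comm]
  exact coneLE_exp_trans h2.2 h1.2

theorem thompson_self_nonneg (hCo : IsOpen (C : Set E)) (hC : ClosureProper C)
    (h0 : (0 : E) ∉ C) (x : {x : E // x ∈ C}) : 0 ≤ thompson C x x := by
  by_contra! h
  have h1 := ((thompson_le_iff hCo hC h0 x x _).mp le_rfl).1
  have h2 : Real.exp (thompson C x x) < 1 := Real.exp_lt_one_iff.mpr h
  have h3 := closure_smul_mem (inv_pos.mpr (sub_pos.mpr h2)) h1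
  rw [show Real.exp (thompson C x x) • (x : E) - x = -((1 - Real.exp (thompson C x x)) • (x : E))
    by module, smul_neg, smul_smul, inv_mul_cancel₀ (sub_pos.mpr h2).ne', one_smul] at h3
  exact h0 (hC x (subset_closure x.2) h3 ▸ x.2)

theorem thompson_self (hCo : IsOpen (C : Set E)) (hC : ClosureProper C)
    (h0 : (0 : E) ∉ C) (x : {x : E // x ∈ C}) : thompson C x x = 0 := by
  refine le_antisymm ((thompson_le_iff hCo hC h0 x x 0).mpr ?_)
    (thompson_self_nonneg hCo hC h0 x)
  simpa using coneLE_refl x.2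

theorem thompson_nonneg (hCo : IsOpen (C : Set E)) (hC : ClosureProper C)
    (h0 : (0 : E) ∉ C) (x y : {x : E // x ∈ C}) : 0 ≤ thompson C x y := by
  have := thompson_triangle hCo hC h0 x y x
  rw [thompson_self hCo hC h0, thompson_comm y x] at this
  linarith

theorem eventually_thompson_le (hCo : IsOpen (C : Set E)) (hC : ClosureProper C)
    (h0 : (0 : E) ∉ C) (x : {x : E // x ∈ C}) {ε : ℝ} (hε : 0 < ε) :
    ∀ᶠ y in 𝓝 x, thompson C y x ≤ ε := by
  have h1 : IsOpen {y : {x : E // x ∈ C} | Real.exp ε • (x : E) - y ∈ C} :=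
    hCo.preimage (by fun_prop)
  have h2 : IsOpen {y : {x : E // x ∈ C} | Real.exp ε • (y : E) - x ∈ C} :=
    hCo.preimage (by fun_prop)
  have hx : Real.exp ε • (x : E) - x ∈ C := by
    rw [show Real.exp ε • (x : E) - x = (Real.exp ε - 1) • (x : E) by module]
    exact C.smul_mem (sub_pos.mpr (Real.one_lt_exp_iff.mpr hε)) x.2
  filter_upwards [h1.mem_nhds hx, h2.mem_nhds hx] with y hy1 hy2
  exact (thompson_le_iff hCo hC h0 y x ε).mpr ⟨subset_closure hy1, subset_closure hy2⟩

theorem continuous_thompson (hCo : IsOpen (C : Set E)) (hC : ClosureProper C)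
    (h0 : (0 : E) ∉ C) :
    Continuous fun z : {x : E // x ∈ C} × {x : E // x ∈ C} => thompson C z.1 z.2 := by
  refine continuous_iff_continuousAt.mpr fun ⟨x, y⟩ => Metric.tendsto_nhds.mpr fun ε hε => ?_
  have h3 : 0 < ε / 3 := by positivity
  filter_upwards [(eventually_thompson_le hCo hC h0 x h3).prod_nhds
    (eventually_thompson_le hCo hC h0 y h3)] with ⟨u, v⟩ ⟨hu, hv⟩
  change thompson C u x ≤ ε / 3 at hu
  change thompson C v y ≤ ε / 3 at hv
  change dist (thompson C u v) (thompson C x y) < ε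
  have a1 := thompson_triangle hCo hC h0 u x v
  have a2 := thompson_triangle hCo hC h0 x y v
  have a3 := thompson_triangle hCo hC h0 x u y
  have a4 := thompson_triangle hCo hC h0 u v y
  rw [thompson_comm y v] at a2
  rw [thompson_comm x u] at a3
  rw [Real.dist_eq, abs_sub_lt_iff]
  constructor <;> linarith

/-- In finite dimension a closed proper cone is normal. -/
theorem ClosureProper.exists_norm_le [FiniteDimensional ℝ E] (hC : ClosureProper C) :
    ∃ k : ℝ, 0 ≤ k ∧ ∀ x y : E, x ∈ closure (C : Set E) → y - x ∈ closure (C : Set E) →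
      ‖x‖ ≤ k * ‖y‖ := by
  set S : Set E := Metric.sphere 0 1 ∩ closure (C : Set E)
  have hS : IsCompact S := (isCompact_sphere 0 1).inter_right isClosed_closure
  rcases S.eq_empty_or_nonempty with hSe | hSne
  · refine ⟨0, le_rfl, fun x y hx _ => ?_⟩
    rcases eq_or_ne x 0 with rfl | hx0
    · simp
    · exfalso
      have : (‖x‖⁻¹ • x) ∈ S := by
        refine ⟨?_, closure_smul_mem (inv_pos.mpr (norm_pos_iff.mpr hx0)) hx⟩
        simp [norm_smul, inv_mul_cancel₀ (norm_ne_zero_iff.mpr hx0)]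
      rw [hSe] at this
      exact this
  -- By properness and compactness, `-u` keeps a distance at least `δ > 0` from the closed cone for
  -- every unit vector `u` in it. Scaled by `‖x‖⁻¹`, the point `y - x` of the cone lies at distance
  -- `‖y‖ / ‖x‖` from `-x`.
  · obtain ⟨u, hu, hmin⟩ := hS.exists_isMinOn hSne
      (f := fun x => Metric.infDist (-x) (closure (C : Set E)))
      (((Metric.continuous_infDist_pt _).comp continuous_neg).continuousOn)
    have hne : (closure (C : Set E)).Nonempty := ⟨u, hu.2⟩
    have hδ : 0 < Metric.infDist (-u) (closure (C : Set E)) := by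
      refine (isClosed_closure.notMem_iff_infDist_pos hne).mp fun h => ?_
      have h1 : ‖u‖ = 1 := by simpa using hu.1
      rw [hC u hu.2 h, norm_zero] at h1
      exact zero_ne_one h1
    set δ := Metric.infDist (-u) (closure (C : Set E))
    refine ⟨δ⁻¹, (inv_pos.mpr hδ).le, fun x y hx hyx => ?_⟩
    rcases eq_or_ne x 0 with rfl | hx0
    · rw [norm_zero]; positivity
    have hxn : 0 < ‖x‖ := norm_pos_iff.mpr hx0
    have hmem : (‖x‖⁻¹ • x) ∈ S := by
      refine ⟨?_, closure_smul_mem (inv_pos.mpr hxn) hx⟩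
      simp [norm_smul, inv_mul_cancel₀ hxn.ne']
    have h1 : δ ≤ Metric.infDist (-(‖x‖⁻¹ • x)) (closure (C : Set E)) := hmin hmem
    have h2 := Metric.infDist_le_dist_of_mem (x := -(‖x‖⁻¹ • x))
      (closure_smul_mem (inv_pos.mpr hxn) hyx)
    have h3 : dist (-(‖x‖⁻¹ • x)) (‖x‖⁻¹ • (y - x)) = ‖x‖⁻¹ * ‖y‖ := by
      rw [dist_comm, dist_eq_norm, show ‖x‖⁻¹ • (y - x) - -(‖x‖⁻¹ • x) = ‖x‖⁻¹ • y by module,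
        norm_smul, norm_inv, norm_norm]
    have h4 : δ ≤ ‖x‖⁻¹ * ‖y‖ := (h1.trans h2).trans_eq h3
    rw [inv_mul_eq_div, le_div_iff₀ hxn] at h4
    rw [inv_mul_eq_div, le_div_iff₀ hδ]
    linarith

/-- The ball is a closed order interval of `E`, bounded by normality. It stays inside `C` because
its lower end `exp(-R)•e` is in the open cone. -/
theorem isCompact_thompson_le [FiniteDimensional ℝ E] (hCo : IsOpen (C : Set E))
    (hC : ClosureProper C) (h0 : (0 : E) ∉ C) (e : {x : E // x ∈ C}) (R : ℝ) :
    IsCompact {x : {x : E // x ∈ C} | thompson C e x ≤ R} := by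
  have : ProperSpace E := FiniteDimensional.proper ℝ E
  rw [Topology.IsEmbedding.subtypeVal.isCompact_iff]
  obtain ⟨k, hk0, hk⟩ := hC.exists_norm_le
  have himg : (Subtype.val '' {x : {x : E // x ∈ C} | thompson C e x ≤ R}) =
      {x : E | coneLE C (e : E) (Real.exp R • x)} ∩ {x : E | coneLE C x (Real.exp R • (e : E))} := by
    ext x
    constructor
    · rintro ⟨y, hy, rfl⟩
      exact (thompson_le_iff hCo hC h0 e y R).mp hy
    · rintro ⟨h1, h2⟩
      have hx : x ∈ C := by
        have h3 := C.smul_mem (inv_pos.mpr (Real.exp_pos R)) (add_mem_of_mem_closure hCo e.2 h1)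
        rwa [add_sub_cancel, smul_smul, inv_mul_cancel₀ (Real.exp_pos R).ne', one_smul] at h3
      exact ⟨⟨x, hx⟩, (thompson_le_iff hCo hC h0 e ⟨x, hx⟩ R).mpr ⟨h1, h2⟩, rfl⟩
  refine Metric.isCompact_of_isClosed_isBounded ?_ ?_
  · rw [himg]
    exact ((isClosed_coneLE C).preimage
        (by fun_prop : Continuous fun x : E => ((e : E), Real.exp R • x))).inter
      ((isClosed_coneLE C).preimage
        (by fun_prop : Continuous fun x : E => (x, Real.exp R • (e : E))))
  · refine (Metric.isBounded_closedBall (x := (0 : E)) (r := k * ‖Real.exp R • (e : E)‖)).subset ?_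
    rintro _ ⟨x, hx, rfl⟩
    rw [mem_closedBall_zero_iff]
    exact hk _ _ (subset_closure x.2) ((thompson_le_iff hCo hC h0 e x R).mp hx).2

/-- Here every positive factor is admissible, the gauge is `0`, and the convention `Real.log 0 = 0`
gives the trivial metric. -/
theorem thompson_eq_zero_of_subsingleton [Subsingleton E] (x y : {x : E // x ∈ C}) :
    thompson C x y = 0 := by
  have hg : ∀ x y : {x : E // x ∈ C}, coneGauge C (x : E) (y : E) = 0 := by
    intro x y
    have : {t : ℝ | 0 < t ∧ coneLE C (x : E) (t • (y : E))} = Set.Ioi 0 := by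
      ext t
      refine ⟨fun h => h.1, fun h => ⟨h, ?_⟩⟩
      rw [Subsingleton.elim (t • (y : E)) x]
      exact coneLE_refl x.2
    rw [coneGauge, this, csInf_Ioi]
  rw [thompson, hg, hg, Real.log_zero, max_self]

end ConeGeometry

/-! ### The stochastic order: antisymmetry, weak closedness, tail bounds, convergence. -/

section StochasticOrder

variable {E : Type*} [NormedAddCommGroup E] [NormedSpace ℝ E] {C : ConvexCone ℝ E}

/-- A Thompson ball of radius `s` confines `y - exp(-s)•x` between `0` and `(exp s - exp(-s))•x`,
which is small in norm by normality. -/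
theorem exists_forall_thompson_le_mem [FiniteDimensional ℝ E] (hCo : IsOpen (C : Set E))
    (hC : ClosureProper C) (h0 : (0 : E) ∉ C) {x : {x : E // x ∈ C}}
    {O : Set {x : E // x ∈ C}} (hO : O ∈ 𝓝 x) :
    ∃ s : ℝ, 0 < s ∧ ∀ y, thompson C x y ≤ s → y ∈ O := by
  obtain ⟨k, hk0, hk⟩ := hC.exists_norm_le
  obtain ⟨ε, hε, hεO⟩ := Metric.mem_nhds_iff.mp hO
  have hc : Continuous fun s : ℝ => k * ‖(Real.exp s - Real.exp (-s)) • (x : E)‖ +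
      ‖(1 - Real.exp (-s)) • (x : E)‖ := by fun_prop
  have h : ∀ᶠ s in 𝓝 (0 : ℝ), k * ‖(Real.exp s - Real.exp (-s)) • (x : E)‖ +
      ‖(1 - Real.exp (-s)) • (x : E)‖ < ε :=
    (isOpen_lt hc continuous_const).mem_nhds (by simpa using hε)
  obtain ⟨s, hs, hs0⟩ := ((h.filter_mono nhdsWithin_le_nhds).and
    (self_mem_nhdsWithin (s := Set.Ioi (0 : ℝ)))).exists
  refine ⟨s, hs0, fun y hy => hεO ?_⟩
  obtain ⟨h1, h2⟩ := (thompson_le_iff hCo hC h0 x y s).mp hy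
  have h3 := h1.smul (Real.exp_pos (-s))
  rw [smul_smul, ← Real.exp_add, neg_add_cancel, Real.exp_zero, one_smul] at h3
  have h4 := hk ((y : E) - Real.exp (-s) • (x : E)) ((Real.exp s - Real.exp (-s)) • (x : E)) h3
    (by
      rw [show (Real.exp s - Real.exp (-s)) • (x : E) - ((y : E) - Real.exp (-s) • (x : E)) =
        Real.exp s • (x : E) - y by module]
      exact h2)
  rw [Metric.mem_ball, Subtype.dist_eq, dist_eq_norm,
    show (y : E) - x = ((y : E) - Real.exp (-s) • (x : E)) - (1 - Real.exp (-s)) • (x : E)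
      by module]
  exact (norm_sub_le _ _).trans_lt ((add_le_add_left h4 _).trans_lt hs)

variable [MeasurableSpace E]

theorem coneStochLE_of_le {σ : ℕ → ProbabilityMeasure {x : E // x ∈ C}}
    (h : ∀ n, coneStochLE C (σ n) (σ (n + 1))) {m n : ℕ} (hmn : m ≤ n) :
    coneStochLE C (σ m) (σ n) :=
  fun U hU hup => monotone_nat_of_le_succ (f := fun n => (σ n : Measure {x : E // x ∈ C}) U)
    (fun n => h n U hU hup) hmn

theorem coneStochLE_of_ge {σ : ℕ → ProbabilityMeasure {x : E // x ∈ C}}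
    (h : ∀ n, coneStochLE C (σ (n + 1)) (σ n)) {m n : ℕ} (hmn : m ≤ n) :
    coneStochLE C (σ n) (σ m) :=
  fun U hU hup => antitone_nat_of_succ_le (f := fun n => (σ n : Measure {x : E // x ∈ C}) U)
    (fun n => h n U hU hup) hmn

theorem coneWasserstein_eq_zero_of_subsingleton [Subsingleton E] {p : ℝ} (hp : 0 < p)
    (μ ν : ProbabilityMeasure {x : E // x ∈ C}) : coneWasserstein C p μ ν = 0 := by
  rw [coneWasserstein, wasserstein]
  have h : (⨅ (π : ProbabilityMeasure ({x : E // x ∈ C} × {x : E // x ∈ C}))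
      (_ : IsCoupling π μ ν), ∫⁻ z, ENNReal.ofReal (thompson C z.1 z.2 ^ p)
        ∂(π : Measure ({x : E // x ∈ C} × {x : E // x ∈ C}))) = 0 := by
    refine le_antisymm (iInf₂_le_of_le ⟨(μ : Measure {x : E // x ∈ C}).prod ν, inferInstance⟩
      ⟨?_, ?_⟩ ?_) zero_le
    · simp
    · simp
    · simp [thompson_eq_zero_of_subsingleton, Real.zero_rpow hp.ne']
  rw [h, ENNReal.zero_rpow_of_pos (by positivity)]

variable [BorelSpace E]

/-- The open upper sets generate the Borel `σ`-algebra of the cone. -/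
theorem eq_generateFrom_open_upper [FiniteDimensional ℝ E] (hCo : IsOpen (C : Set E))
    (hC : ClosureProper C) (h0 : (0 : E) ∉ C) :
    (inferInstance : MeasurableSpace {x : E // x ∈ C}) = MeasurableSpace.generateFrom
      {U : Set {x : E // x ∈ C} | IsOpen U ∧ ∀ x ∈ U, ∀ y : {x : E // x ∈ C},
        coneLE C (x : E) (y : E) → y ∈ U} := by
  set G := {U : Set {x : E // x ∈ C} | IsOpen U ∧ ∀ x ∈ U, ∀ y : {x : E // x ∈ C},
        coneLE C (x : E) (y : E) → y ∈ U}
  refine le_antisymm ?_ (MeasurableSpace.generateFrom_le fun U hU => hU.1.measurableSet)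
  rw [BorelSpace.measurable_eq (α := {x : E // x ∈ C})]
  refine MeasurableSpace.generateFrom_le fun O (hO : IsOpen O) => ?_
  have : ProperSpace E := FiniteDimensional.proper ℝ E
  -- An open upper set intersected with the complement of one. This is why the lower bound is strict
  -- and the upper bound is not; the set is still a neighbourhood of `x` inside the Thompson ball,
  -- and countably many of them cover `O`.
  set N : {x : E // x ∈ C} → ℝ → Set {x : E // x ∈ C} := fun x s =>
    {y | Real.exp s • (y : E) - x ∈ C} ∩ {y | coneLE C (y : E) (Real.exp s • (x : E))} with hN
  have hNm : ∀ x s, MeasurableSet[MeasurableSpace.generateFrom G] (N x s) := by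
    intro x s
    refine MeasurableSet.inter (MeasurableSpace.measurableSet_generateFrom ⟨?_, ?_⟩)
      (MeasurableSet.of_compl (MeasurableSpace.measurableSet_generateFrom ⟨?_, ?_⟩))
    · exact hCo.preimage (by fun_prop)
    · intro y hy z hyz
      have := add_mem_of_mem_closure hCo hy (hyz.smul (Real.exp_pos s))
      rwa [sub_add_eq_add_sub, add_sub_cancel] at this
    · exact ((isClosed_coneLE C).preimage (by fun_prop :
        Continuous fun y : {x : E // x ∈ C} => ((y : E), Real.exp s • (x : E)))).isOpen_compl
    · exact fun y hy z hyz hz => hy (hyz.trans hz)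
  choose s hs hsO using fun x : O =>
    exists_forall_thompson_le_mem hCo hC h0 (hO.mem_nhds x.2)
  have hsub : ∀ x : O, N x (s x) ⊆ O := fun x y hy =>
    hsO x y ((thompson_le_iff hCo hC h0 x y _).mpr ⟨subset_closure hy.1, hy.2⟩)
  have hnhds : ∀ x : O, N x (s x) ∈ 𝓝 (x : {x : E // x ∈ C}) := by
    intro x
    have hx : Real.exp (s x) • ((x : {x : E // x ∈ C}) : E) - (x : {x : E // x ∈ C}) ∈ C := by
      rw [show Real.exp (s x) • ((x : {x : E // x ∈ C}) : E) - (x : {x : E // x ∈ C}) =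
        (Real.exp (s x) - 1) • ((x : {x : E // x ∈ C}) : E) by module]
      exact C.smul_mem (sub_pos.mpr (Real.one_lt_exp_iff.mpr (hs x))) (x : {x : E // x ∈ C}).2
    have o1 : IsOpen {y : {x : E // x ∈ C} |
        Real.exp (s x) • (y : E) - (x : {x : E // x ∈ C}) ∈ C} := hCo.preimage (by fun_prop)
    have o2 : IsOpen {y : {x : E // x ∈ C} |
        Real.exp (s x) • ((x : {x : E // x ∈ C}) : E) - y ∈ C} := hCo.preimage (by fun_prop)
    filter_upwards [o1.mem_nhds hx, o2.mem_nhds hx] with y h1 h2 using ⟨h1, subset_closure h2⟩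
  obtain ⟨T, hT, hTO⟩ := TopologicalSpace.isOpen_iUnion_countable
    (fun x : O => interior (N x (s x))) fun _ => isOpen_interior
  have hOT : O = ⋃ x ∈ T, N x (s x) := by
    refine Set.Subset.antisymm (fun y hy => ?_) (Set.iUnion₂_subset fun x _ => hsub x)
    have h1 : y ∈ ⋃ x : O, interior (N x (s x)) :=
      Set.mem_iUnion.mpr ⟨⟨y, hy⟩, mem_interior_iff_mem_nhds.mpr (hnhds ⟨y, hy⟩)⟩
    rw [← hTO] at h1
    exact Set.iUnion₂_mono (fun x _ => interior_subset) h1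
  rw [hOT]
  exact MeasurableSet.biUnion hT fun x _ => hNm x _

theorem coneStochLE_antisymm [FiniteDimensional ℝ E] (hCo : IsOpen (C : Set E))
    (hC : ClosureProper C) (h0 : (0 : E) ∉ C) {μ ν : ProbabilityMeasure {x : E // x ∈ C}}
    (h1 : coneStochLE C μ ν) (h2 : coneStochLE C ν μ) : μ = ν := by
  refine ProbabilityMeasure.toMeasure_injective (ext_of_generate_finite _ (eq_generateFrom_open_upper hCo hC h0) ?_
    (fun U hU => le_antisymm (h1 U hU.1 hU.2) (h2 U hU.1 hU.2)) (by simp))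
  rintro U hU V hV -
  exact ⟨hU.1.inter hV.1, fun x hx y hxy => ⟨hU.2 x hx.1 y hxy, hV.2 x hx.2 y hxy⟩⟩

/-- The stochastic order is closed under weak limits. -/
theorem coneStochLE_of_tendsto (hCo : IsOpen (C : Set E))
    {ι : Type*} {L : Filter ι} [L.NeBot] {μ ν : ι → ProbabilityMeasure {x : E // x ∈ C}}
    {μ₀ ν₀ : ProbabilityMeasure {x : E // x ∈ C}} (hμ : Tendsto μ L (𝓝 μ₀))
    (hν : Tendsto ν L (𝓝 ν₀)) (h : ∀ᶠ i in L, coneStochLE C (μ i) (ν i)) :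
    coneStochLE C μ₀ ν₀ := by
  intro U hU hup
  set D : ℝ → {x : E // x ∈ C} → {x : E // x ∈ C} := fun s x =>
    ⟨Real.exp (-s) • (x : E), C.smul_mem (Real.exp_pos _) x.2⟩ with hD
  have hDc : ∀ s, Continuous (D s) := fun s => by fun_prop
  -- The portmanteau theorem bounds open sets from one side and closed sets from the other.
  -- Shrinking by scalars bridges the gap: the `V n` are open upper sets that increase to `U`, with
  -- closures inside `U`.
  set V : ℕ → Set {x : E // x ∈ C} := fun n => D (1 / ((n : ℝ) + 1)) ⁻¹' U with hV
  have hpos : ∀ n : ℕ, 0 < 1 / ((n : ℝ) + 1) := fun n => by positivity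
  have hVo : ∀ n, IsOpen (V n) := fun n => hU.preimage (hDc _)
  have hVup : ∀ n, ∀ x ∈ V n, ∀ y : {x : E // x ∈ C}, coneLE C (x : E) (y : E) → y ∈ V n :=
    fun n x hx y hxy => hup _ hx _ (hxy.smul (Real.exp_pos _))
  have hVcl : ∀ n, closure (V n) ⊆ U := by
    intro n x hx
    have hO : IsOpen {u : {x : E // x ∈ C} | (x : E) - D (1 / ((n : ℝ) + 1)) u ∈ C} :=
      hCo.preimage (by fun_prop)
    obtain ⟨u, hu, huV⟩ := mem_closure_iff.mp hx _ hO (by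
      change (x : E) - Real.exp (-(1 / ((n : ℝ) + 1))) • (x : E) ∈ C
      rw [show (x : E) - Real.exp (-(1 / ((n : ℝ) + 1))) • (x : E) =
        (1 - Real.exp (-(1 / ((n : ℝ) + 1)))) • (x : E) by module]
      exact C.smul_mem (sub_pos.mpr (Real.exp_lt_one_iff.mpr (neg_neg_of_pos (hpos n)))) x.2)
    exact hup _ huV x (subset_closure hu)
  have hVmono : Monotone V := by
    intro m n hmn x hx
    refine hup _ hx _ (coneLE_smul_smul x.2 (Real.exp_le_exp.mpr (neg_le_neg ?_)))
    exact one_div_le_one_div_of_le (by positivity) (by gcongr)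
  have hVU : ⋃ n, V n = U := by
    refine Set.Subset.antisymm (Set.iUnion_subset fun n => subset_closure.trans (hVcl n)) ?_
    intro x hx
    have hc : Continuous fun s => D s x := by fun_prop
    have h1 : Tendsto (fun n : ℕ => D (1 / ((n : ℝ) + 1)) x) atTop (𝓝 (D 0 x)) :=
      (hc.tendsto 0).comp tendsto_one_div_add_atTop_nhds_zero_nat
    have h2 : D 0 x = x := Subtype.ext (by simp [hD])
    rw [h2] at h1
    obtain ⟨n, hn⟩ := (h1.eventually (hU.mem_nhds hx)).exists
    exact Set.mem_iUnion.mpr ⟨n, hn⟩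
  have hle : ∀ n, (μ₀ : Measure {x : E // x ∈ C}) (V n) ≤ (ν₀ : Measure {x : E // x ∈ C}) U := by
    intro n
    calc (μ₀ : Measure {x : E // x ∈ C}) (V n)
        ≤ L.liminf fun i => (μ i : Measure {x : E // x ∈ C}) (V n) :=
          ProbabilityMeasure.le_liminf_measure_open_of_tendsto hμ (hVo n)
      _ ≤ L.liminf fun i => (ν i : Measure {x : E // x ∈ C}) (closure (V n)) := by
          refine liminf_le_liminf ?_
          filter_upwards [h] with i hi
          exact (hi _ (hVo n) (hVup n)).trans (measure_mono subset_closure)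
      _ ≤ L.limsup fun i => (ν i : Measure {x : E // x ∈ C}) (closure (V n)) :=
          liminf_le_limsup
      _ ≤ (ν₀ : Measure {x : E // x ∈ C}) (closure (V n)) :=
          ProbabilityMeasure.limsup_measure_closed_le_of_tendsto hν isClosed_closure
      _ ≤ _ := measure_mono (hVcl n)
  rw [← hVU, hVmono.measure_iUnion, hVU]
  exact iSup_le hle

/-- A point outside the ball fails `x ≤ exp(R)•e`, an open upper condition controlled by `β`, or
lies outside the open upper set `V`, whose complement is controlled by `α`. -/
theorem measure_lt_thompson_le (hCo : IsOpen (C : Set E)) (hC : ClosureProper C)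
    (h0 : (0 : E) ∉ C) {α σ β : ProbabilityMeasure {x : E // x ∈ C}}
    (h1 : coneStochLE C α σ) (h2 : coneStochLE C σ β)
    (e : {x : E // x ∈ C}) (R : ℝ) :
    (σ : Measure {x : E // x ∈ C}) {x | R < thompson C e x} ≤
      (α : Measure {x : E // x ∈ C}) {x | R ≤ thompson C e x} +
        (β : Measure {x : E // x ∈ C}) {x | R ≤ thompson C e x} := by
  set U : Set {x : E // x ∈ C} := {x | ¬ coneLE C (x : E) (Real.exp R • (e : E))}
  set V : Set {x : E // x ∈ C} := {x | Real.exp R • (x : E) - e ∈ C}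
  have hU : IsOpen U := ((isClosed_coneLE C).preimage (by fun_prop :
    Continuous fun y : {x : E // x ∈ C} => ((y : E), Real.exp R • (e : E)))).isOpen_compl
  have hV : IsOpen V := hCo.preimage (by fun_prop)
  have hUup : ∀ x ∈ U, ∀ y : {x : E // x ∈ C}, coneLE C (x : E) (y : E) → y ∈ U :=
    fun x hx y hxy hy => hx (hxy.trans hy)
  have hVup : ∀ x ∈ V, ∀ y : {x : E // x ∈ C}, coneLE C (x : E) (y : E) → y ∈ V := by
    intro y hy z hyz
    have := add_mem_of_mem_closure hCo hy (hyz.smul (Real.exp_pos R))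
    rwa [sub_add_eq_add_sub, add_sub_cancel] at this
  have hsub : {x | R < thompson C e x} ⊆ Vᶜ ∪ U := by
    intro x hx
    by_contra hn
    simp only [Set.mem_union, Set.mem_compl_iff, not_or, not_not, U, V, Set.mem_ofPred_eq] at hn
    exact (not_le.mpr hx) ((thompson_le_iff hCo hC h0 e x R).mpr ⟨subset_closure hn.1, hn.2⟩)
  have hVsub : Vᶜ ⊆ {x | R ≤ thompson C e x} := by
    intro x hx
    by_contra hn
    replace hn : thompson C e x < R := not_le.mp (by simpa using hn)
    refine hx ?_
    have h3 := ((thompson_le_iff hCo hC h0 e x _).mp le_rfl).1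
    have h4 := add_mem_of_mem_closure hCo (C.smul_mem (sub_pos.mpr (Real.exp_lt_exp.mpr hn)) x.2) h3
    rwa [show (Real.exp R - Real.exp (thompson C e x)) • (x : E) +
      (Real.exp (thompson C e x) • (x : E) - e) = Real.exp R • (x : E) - e by module] at h4
  have hUsub : U ⊆ {x | R ≤ thompson C e x} := by
    intro x hx
    by_contra hn
    replace hn : thompson C e x < R := not_le.mp (by simpa using hn)
    exact hx ((thompson_le_iff hCo hC h0 e x R).mp hn.le).2
  have hVc : (σ : Measure {x : E // x ∈ C}) Vᶜ ≤ (α : Measure {x : E // x ∈ C}) Vᶜ := by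
    rw [prob_compl_eq_one_sub hV.measurableSet, prob_compl_eq_one_sub hV.measurableSet]
    exact tsub_le_tsub_left (h1 V hV hVup) 1
  calc (σ : Measure {x : E // x ∈ C}) {x | R < thompson C e x}
      ≤ (σ : Measure {x : E // x ∈ C}) Vᶜ + (σ : Measure {x : E // x ∈ C}) U :=
        (measure_mono hsub).trans (measure_union_le _ _)
    _ ≤ (α : Measure {x : E // x ∈ C}) Vᶜ + (β : Measure {x : E // x ∈ C}) U :=
        add_le_add hVc (h2 U hU hUup)
    _ ≤ _ := add_le_add (measure_mono hVsub) (measure_mono hUsub)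

/-- Layer-cake integration of the tail bound, level `t` corresponding to radius `(t + q)^(1/p)`. The
case `q = 0` bounds moments; large `q` gives uniform integrability. -/
theorem lintegral_thompson_sub_le (hCo : IsOpen (C : Set E)) (hC : ClosureProper C)
    (h0 : (0 : E) ∉ C) {α σ β : ProbabilityMeasure {x : E // x ∈ C}}
    (h1 : coneStochLE C α σ) (h2 : coneStochLE C σ β)
    (e : {x : E // x ∈ C}) {p : ℝ} (hp : 0 < p) (q : ℝ≥0) :
    ∫⁻ x, (ENNReal.ofReal (thompson C e x ^ p) - q) ∂(σ : Measure {x : E // x ∈ C}) ≤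
      ∫⁻ x, (ENNReal.ofReal (thompson C e x ^ p) - q) ∂(α : Measure {x : E // x ∈ C}) +
      ∫⁻ x, (ENNReal.ofReal (thompson C e x ^ p) - q) ∂(β : Measure {x : E // x ∈ C}) := by
  have hm : Measurable fun x => max (thompson C e x ^ p - q) 0 := by
    have : Measurable fun x => thompson C e x :=
      (((continuous_thompson hCo hC h0).comp
        (by fun_prop : Continuous fun x : {x : E // x ∈ C} => (e, x))).measurable)
    exact ((this.pow_const p).sub_const _).max measurable_const
  have hnn : ∀ x, 0 ≤ max (thompson C e x ^ p - q) 0 := fun x => le_max_right _ _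
  have heq : (fun x => ENNReal.ofReal (thompson C e x ^ p) - q) =
      fun x => ENNReal.ofReal (max (thompson C e x ^ p - q) 0) := by
    funext x
    rw [ENNReal.ofReal_max, ENNReal.ofReal_zero, max_eq_left zero_le,
      ENNReal.ofReal_sub _ q.coe_nonneg, ENNReal.ofReal_coe_nnreal]
  -- Strict levels for `σ` and non-strict ones for `α` and `β` match the form of the tail bound.
  rw [heq, lintegral_eq_lintegral_meas_lt _ (ae_of_all _ hnn) hm.aemeasurable,
    lintegral_eq_lintegral_meas_le _ (ae_of_all _ hnn) hm.aemeasurable,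
    lintegral_eq_lintegral_meas_le _ (ae_of_all _ hnn) hm.aemeasurable]
  rw [← lintegral_add_left]
  · refine setLIntegral_mono' measurableSet_Ioi fun t ht => ?_
    have ht : 0 < t := ht
    have hqt : 0 ≤ t + (q : ℝ) := add_nonneg ht.le q.2
    have key : ∀ x, ((t + q) ^ p⁻¹ < thompson C e x ↔ t < max (thompson C e x ^ p - q) 0) ∧
        ((t + q) ^ p⁻¹ ≤ thompson C e x ↔ t ≤ max (thompson C e x ^ p - q) 0) := by
      intro x
      have hx := thompson_nonneg hCo hC h0 e x
      rw [lt_max_iff, le_max_iff, or_iff_left (not_lt.mpr ht.le), or_iff_left (not_le.mpr ht),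
        Real.rpow_inv_lt_iff_of_pos hqt hx hp, Real.rpow_inv_le_iff_of_pos hqt hx hp,
        lt_sub_iff_add_lt, le_sub_iff_add_le]
      exact ⟨Iff.rfl, Iff.rfl⟩
    have := measure_lt_thompson_le hCo hC h0 h1 h2 e ((t + q) ^ p⁻¹)
    simpa only [fun x => (key x).1, fun x => (key x).2] using this
  · exact Antitone.measurable fun s t hst => measure_mono fun x hx => le_trans hst hx

theorem eventually_lintegral_thompson_sub_le (hCo : IsOpen (C : Set E)) (hC : ClosureProper C)
    (h0 : (0 : E) ∉ C) {p : ℝ} (e : {x : E // x ∈ C})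
    {α : ProbabilityMeasure {x : E // x ∈ C}}
    (hα : ∫⁻ x, ENNReal.ofReal (thompson C e x ^ p) ∂(α : Measure {x : E // x ∈ C}) < ∞)
    {δ : ℝ≥0∞} (hδ : 0 < δ) :
    ∀ᶠ n : ℕ in atTop, ∫⁻ x, (ENNReal.ofReal (thompson C e x ^ p) - n)
      ∂(α : Measure {x : E // x ∈ C}) ≤ δ := by
  have hm : Measurable fun x => ENNReal.ofReal (thompson C e x ^ p) := by
    have : Measurable fun x => thompson C e x :=
      (((continuous_thompson hCo hC h0).comp
        (by fun_prop : Continuous fun x : {x : E // x ∈ C} => (e, x))).measurable)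
    exact (this.pow_const p).ennreal_ofReal
  have h : Tendsto (fun n : ℕ => ∫⁻ x, (ENNReal.ofReal (thompson C e x ^ p) - n)
      ∂(α : Measure {x : E // x ∈ C})) atTop (𝓝 (∫⁻ _, 0 ∂(α : Measure {x : E // x ∈ C}))) := by
    refine tendsto_lintegral_of_dominated_convergence _ (fun n => hm.sub_const _)
      (fun n => ae_of_all _ fun x => tsub_le_self) hα.ne (ae_of_all _ fun x => ?_)
    refine tendsto_const_nhds.congr' ?_
    obtain ⟨N, hN⟩ := exists_nat_ge (thompson C e x ^ p)
    filter_upwards [eventually_ge_atTop N] with n hn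
    refine (tsub_eq_zero_of_le ?_).symm
    rw [← ENNReal.ofReal_natCast]
    exact ENNReal.ofReal_le_ofReal (hN.trans (by exact_mod_cast hn))
  rw [lintegral_zero] at h
  exact (ENNReal.tendsto_nhds_zero.mp h) δ hδ

theorem tendsto_measure_le_thompson (hCo : IsOpen (C : Set E)) (hC : ClosureProper C)
    (h0 : (0 : E) ∉ C) (e : {x : E // x ∈ C}) (α : ProbabilityMeasure {x : E // x ∈ C}) :
    Tendsto (fun n : ℕ => (α : Measure {x : E // x ∈ C}) {x | (n : ℝ) ≤ thompson C e x}) atTop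
      (𝓝 0) := by
  have hm : Measurable fun x => thompson C e x :=
    (((continuous_thompson hCo hC h0).comp
      (by fun_prop : Continuous fun x : {x : E // x ∈ C} => (e, x))).measurable)
  have h := tendsto_measure_iInter_atTop (μ := (α : Measure {x : E // x ∈ C}))
    (s := fun n : ℕ => {x | (n : ℝ) ≤ thompson C e x})
    (fun n => (measurableSet_le measurable_const hm).nullMeasurableSet)
    (fun m n hmn x hx => le_trans (Nat.cast_le (α := ℝ).mpr hmn) hx) ⟨0, measure_ne_top _ _⟩
  have he : ⋂ n : ℕ, {x | (n : ℝ) ≤ thompson C e x} = ∅ := by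
    refine Set.eq_empty_of_forall_notMem fun x hx => ?_
    obtain ⟨n, hn⟩ := exists_nat_gt (thompson C e x)
    exact absurd (Set.mem_iInter.mp hx n) (not_le.mpr hn)
  rwa [he, measure_empty] at h

/-- The order intervals of the stochastic order are relatively compact. -/
theorem isCompact_closure_coneStochLE [FiniteDimensional ℝ E] (hCo : IsOpen (C : Set E))
    (hC : ClosureProper C) (h0 : (0 : E) ∉ C) (e : {x : E // x ∈ C})
    (α β : ProbabilityMeasure {x : E // x ∈ C}) :
    IsCompact (closure {σ | coneStochLE C α σ ∧ coneStochLE C σ β}) := by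
  refine isCompact_closure_of_isTightMeasureSet
    (isTightMeasureSet_iff_exists_isCompact_measure_compl_le.mpr fun ε hε => ?_)
  have h := (tendsto_measure_le_thompson hCo hC h0 e α).add
    (tendsto_measure_le_thompson hCo hC h0 e β)
  rw [add_zero] at h
  obtain ⟨n, hn⟩ := ((ENNReal.tendsto_nhds_zero.mp h) ε hε).exists
  refine ⟨_, isCompact_thompson_le hCo hC h0 e n, ?_⟩
  rintro _ ⟨σ, hσ, rfl⟩
  refine le_trans (le_of_eq ?_) ((measure_lt_thompson_le hCo hC h0 hσ.1 hσ.2 e n).trans hn)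
  congr 1
  ext x
  simp

/-- A sequence in an order interval of `P^p` whose cluster points are comparable in both
directions converges in the Wasserstein distance. -/
theorem exists_tendsto_coneWasserstein [FiniteDimensional ℝ E] (hCo : IsOpen (C : Set E))
    (hC : ClosureProper C) (h0 : (0 : E) ∉ C) {p : ℝ} (hp : 1 ≤ p)
    {α β : ProbabilityMeasure {x : E // x ∈ C}} (hα : α ∈ Pp C p) (hβ : β ∈ Pp C p)
    {σ : ℕ → ProbabilityMeasure {x : E // x ∈ C}} (hασ : ∀ n, coneStochLE C α (σ n))
    (hσβ : ∀ n, coneStochLE C (σ n) β)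
    (hcl : ∀ ρ ρ', MapClusterPt ρ atTop σ → MapClusterPt ρ' atTop σ → coneStochLE C ρ ρ') :
    ∃ σ₀ ∈ Pp C p, coneStochLE C α σ₀ ∧ coneStochLE C σ₀ β ∧ MapClusterPt σ₀ atTop σ ∧
      Tendsto (fun n => coneWasserstein C p (σ n) σ₀) atTop (𝓝 0) := by
  have hp0 : 0 < p := lt_of_lt_of_le one_pos hp
  obtain ⟨e⟩ : Nonempty {x : E // x ∈ C} := α.nonempty
  have hcomp := isCompact_closure_coneStochLE hCo hC h0 e α β
  have hmem : ∀ n, σ n ∈ closure {σ | coneStochLE C α σ ∧ coneStochLE C σ β} :=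
    fun n => subset_closure ⟨hασ n, hσβ n⟩
  obtain ⟨σ₀, -, hσ₀⟩ := hcomp.exists_mapClusterPt_of_frequently
    (Frequently.of_forall (f := atTop) hmem)
  have hlim : Tendsto σ atTop (𝓝 σ₀) := hcomp.tendsto_nhds_of_unique_mapClusterPt
    (Eventually.of_forall hmem) fun ρ _ hρ =>
      coneStochLE_antisymm hCo hC h0 (hcl _ _ hρ hσ₀) (hcl _ _ hσ₀ hρ)
  have hασ₀ : coneStochLE C α σ₀ :=
    coneStochLE_of_tendsto hCo tendsto_const_nhds hlim (Eventually.of_forall hασ)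
  have hσ₀β : coneStochLE C σ₀ β :=
    coneStochLE_of_tendsto hCo hlim tendsto_const_nhds (Eventually.of_forall hσβ)
  refine ⟨σ₀, fun x => ?_, hασ₀, hσ₀β, hσ₀, ?_⟩
  · have := lintegral_thompson_sub_le hCo hC h0 hασ₀ hσ₀β x hp0 0
    simp only [ENNReal.coe_zero, tsub_zero] at this
    exact this.trans_lt (ENNReal.add_lt_top.mpr ⟨hα x, hβ x⟩)
  · refine tendsto_wasserstein_of_tendsto (continuous_thompson hCo hC h0)
      (thompson_nonneg hCo hC h0) (thompson_self hCo hC h0) thompson_comm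
      (thompson_triangle hCo hC h0) hp hlim e fun δ hδ => ?_
    have hδ2 : 0 < δ / 2 := ENNReal.half_pos hδ.ne'
    obtain ⟨n, hn1, hn2⟩ := ((eventually_lintegral_thompson_sub_le hCo hC h0 e (hα e) hδ2).and
      (eventually_lintegral_thompson_sub_le hCo hC h0 e (hβ e) hδ2)).exists
    have key : ∀ τ, coneStochLE C α τ → coneStochLE C τ β →
        ∫⁻ x, (ENNReal.ofReal (thompson C e x ^ p) - (n : ℝ≥0))
          ∂(τ : Measure {x : E // x ∈ C}) ≤ δ := by
      intro τ h1 h2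
      refine (lintegral_thompson_sub_le hCo hC h0 h1 h2 e hp0 n).trans ?_
      rw [← ENNReal.add_halves δ]
      exact add_le_add (by simpa using hn1) (by simpa using hn2)
    exact ⟨n, fun k => key _ (hασ k) (hσβ k), key _ hασ₀ hσ₀β⟩

/-- Stochastic bounds holding eventually along a sequence pass to its cluster points. -/
theorem coneStochLE_of_mapClusterPt (hCo : IsOpen (C : Set E))
    {σ : ℕ → ProbabilityMeasure {x : E // x ∈ C}} {ρ τ : ProbabilityMeasure {x : E // x ∈ C}}
    (hρ : MapClusterPt ρ atTop σ) :
    ((∀ᶠ n in atTop, coneStochLE C (σ n) τ) → coneStochLE C ρ τ) ∧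
      ((∀ᶠ n in atTop, coneStochLE C τ (σ n)) → coneStochLE C τ ρ) := by
  obtain ⟨U, hU, hUρ⟩ := mapClusterPt_iff_ultrafilter.mp hρ
  exact ⟨fun h => coneStochLE_of_tendsto hCo hUρ tendsto_const_nhds (hU h),
    fun h => coneStochLE_of_tendsto hCo tendsto_const_nhds hUρ (hU h)⟩

end StochasticOrder

end StochOrder

open StochOrder in
theorem proposition6p4 {E : Type*} [NormedAddCommGroup E] [NormedSpace ℝ E]
    [FiniteDimensional ℝ E] [MeasurableSpace E] [BorelSpace E]
    (C : ConvexCone ℝ E) (hCopen : IsOpen (C : Set E)) (hC : StochOrder.ClosureProper C)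
    (p : ℝ) (hp : 1 ≤ p)
    (μ : ℕ → ProbabilityMeasure {x : E // x ∈ C}) (ν : ProbabilityMeasure {x : E // x ∈ C})
    (hμ : ∀ n, μ n ∈ StochOrder.Pp C p) (hν : ν ∈ StochOrder.Pp C p) :
    ((∀ n, StochOrder.coneStochLE C (μ n) (μ (n + 1))) →
      (∀ n, StochOrder.coneStochLE C (μ n) ν) →
      ∃ μ₀ ∈ StochOrder.Pp C p,
        (∀ n, StochOrder.coneStochLE C (μ n) μ₀) ∧ StochOrder.coneStochLE C μ₀ ν ∧
        Tendsto (fun n => StochOrder.coneWasserstein C p (μ n) μ₀) atTop (𝓝 0)) ∧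
    ((∀ n, StochOrder.coneStochLE C (μ (n + 1)) (μ n)) →
      (∀ n, StochOrder.coneStochLE C ν (μ n)) →
      ∃ μ₀ ∈ StochOrder.Pp C p,
        (∀ n, StochOrder.coneStochLE C μ₀ (μ n)) ∧ StochOrder.coneStochLE C ν μ₀ ∧
        Tendsto (fun n => StochOrder.coneWasserstein C p (μ n) μ₀) atTop (𝓝 0)) := by
  -- In this case `E` is trivial and all Wasserstein distances vanish, so `ν` itself serves as the
  -- limit.
  by_cases h0 : (0 : E) ∈ C
  · have := hC.subsingleton_of_zero_mem hCopen h0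
    refine ⟨fun _ h => ⟨ν, hν, h, fun U _ _ => le_rfl, ?_⟩,
      fun _ h => ⟨ν, hν, h, fun U _ _ => le_rfl, ?_⟩⟩ <;>
    simp only [coneWasserstein_eq_zero_of_subsingleton (one_pos.trans_le hp), tendsto_const_nhds]
  constructor
  · intro hmono hle
    have hup : ∀ ρ, MapClusterPt ρ atTop μ → ∀ n, coneStochLE C (μ n) ρ := fun ρ hρ n =>
      (coneStochLE_of_mapClusterPt hCopen hρ).2
        ((eventually_ge_atTop n).mono fun m hm => coneStochLE_of_le hmono hm)
    obtain ⟨μ₀, hP, -, h2, h3, h4⟩ := exists_tendsto_coneWasserstein hCopen hC h0 hp (hμ 0) hν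
      (fun n => coneStochLE_of_le hmono (Nat.zero_le n)) hle
      -- The cluster point `ρ'` dominates every `μ n`, hence also their cluster point `ρ`.
      fun ρ ρ' hρ hρ' => (coneStochLE_of_mapClusterPt hCopen hρ).1
        (Eventually.of_forall (hup ρ' hρ'))
    exact ⟨μ₀, hP, hup μ₀ h3, h2, h4⟩
  · intro hanti hge
    have hlow : ∀ ρ, MapClusterPt ρ atTop μ → ∀ n, coneStochLE C ρ (μ n) := fun ρ hρ n =>
      (coneStochLE_of_mapClusterPt hCopen hρ).1
        ((eventually_ge_atTop n).mono fun m hm => coneStochLE_of_ge hanti hm)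
    obtain ⟨μ₀, hP, h2, -, h3, h4⟩ := exists_tendsto_coneWasserstein hCopen hC h0 hp hν (hμ 0)
      hge (fun n => coneStochLE_of_ge hanti (Nat.zero_le n))
      fun ρ ρ' hρ hρ' => (coneStochLE_of_mapClusterPt hCopen hρ').2
        (Eventually.of_forall (hlow ρ hρ))
    exact ⟨μ₀, hP, hlow μ₀ h3, h2, h4⟩
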